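/- Let $d$ be a natural number and let $\mathrm{L}(\mathcal{H}_d)$ be the space of linear operators on $\mathcal{H}_d=\mathbb{C}^d$. A quantum channel is a linear map $\Phi:\mathrm{L}(\mathcal{H}_d)\to\mathrm{L}(\mathcal{H}_d)$ that is trace-preserving and completely positive (that is, $\Phi\otimes I_{\mathrm{L}(\mathcal{H}_n)}$ preserves positive semidefiniteness for every $n\ge 1$). Its Kraus operator space is $K(\Phi)=\mathrm{span}_{\mathbb{C}}\{E_k\}$ for any Kraus representation $\Phi(X)=\sum_k E_kXE_k^\dagger$; it does not depend on the representation. Write $|X|=\sqrt{X^\dagger X}$, $\|X\|_1=\mathrm{Tr}|X|$ and, for a linear map $\Theta$ on $\mathrm{L}(\mathcal{H}_d)$, $$\|\Theta\|_\diamond=\sup_{n\ge 1}\ \sup_{\|X\|_1\le 1}\big\|(\Theta\otimes I_{\mathrm{L}(\mathcal{H}_n)})(X)\big\|_1 ,$$ where $X$ ranges over operators on $\mathcal{H}_d\otimes\mathcal{H}_n$. Let $\mathrm{Conv}(\mathbb{U}(\mathcal{H}_d))$ be the convex hull of the unitary channels $X\mapsto UXU^\dagger$, $U$ unitary, and let $$D(\Phi,\mathrm{Conv}(\mathbb{U}(\mathcal{H}_d)))=\inf\{\|\Phi-\Psi\|_\diamond:\Psi\in\mathrm{Conv}(\mathbb{U}(\mathcal{H}_d))\}.$$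 Let $\Phi$ be a quantum channel on $\mathrm{L}(\mathcal{H}_d)$ such that $K(\Phi)$ contains no unitary operator. Then the minimum $$C_\Phi=\min_{L\in K(\Phi)}\frac{\mathrm{Tr}\big[(|L|-I)^2\big]}{d}$$ is attained, $C_\Phi>0$, and $$D(\Phi,\mathrm{Conv}(\mathbb{U}(\mathcal{H}_d)))\ \ge\ C_\Phi .$$ -/

import Mathlib

open scoped ComplexOrder MatrixOrder Kronecker

noncomputable section

namespace QChannel

/-- `L(H_d)`, the linear operators on `H_d = ℂ^d`, as matrices. -/
abbrev Op (d : ℕ) : Type := Matrix (Fin d) (Fin d) ℂ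

/-- `T(H_d)`, the super-operators on `L(H_d)`. -/
abbrev SuperOp (d : ℕ) : Type := Op d →ₗ[ℂ] Op d

/-- The super-operator `Φ ⊗ I_{L(H_n)}` on `L(H_d ⊗ H_n)`: it applies `Φ` to each of the
`n × n` blocks, see `ampliation_kronecker`. -/
def ampliation {d : ℕ} (n : ℕ) (Φ : SuperOp d) :
    Matrix (Fin d × Fin n) (Fin d × Fin n) ℂ →ₗ[ℂ] Matrix (Fin d × Fin n) (Fin d × Fin n) ℂ where
  toFun X := Matrix.of fun p q =>
    Φ (Matrix.of fun i j => X (i, p.2) (j, q.2)) p.1 q.1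
  map_add' X Y := by
    ext p q
    have h : (Matrix.of fun i j => (X + Y) (i, p.2) (j, q.2) : Op d)
        = (Matrix.of fun i j => X (i, p.2) (j, q.2))
          + (Matrix.of fun i j => Y (i, p.2) (j, q.2)) := by
      ext i j; simp
    simp only [Matrix.of_apply, Matrix.add_apply] at *
    rw [h, map_add, Matrix.add_apply]
  map_smul' c X := by
    ext p q
    have h : (Matrix.of fun i j => (c • X) (i, p.2) (j, q.2) : Op d)
        = c • (Matrix.of fun i j => X (i, p.2) (j, q.2)) := by
      ext i j; simp
    simp only [Matrix.of_apply, Matrix.smul_apply, RingHom.id_apply] at *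
    rw [h, map_smul, Matrix.smul_apply]

theorem ampliation_kronecker {d : ℕ} (n : ℕ) (Φ : SuperOp d) (A : Op d)
    (B : Matrix (Fin n) (Fin n) ℂ) : ampliation n Φ (A ⊗ₖ B) = Φ A ⊗ₖ B := by
  ext p q
  have h : (Matrix.of fun i j => (A ⊗ₖ B) (i, p.2) (j, q.2) : Op d) = B p.2 q.2 • A := by
    ext i j; simp [Matrix.kroneckerMap_apply, mul_comm]
  change Φ (Matrix.of fun i j => (A ⊗ₖ B) (i, p.2) (j, q.2)) p.1 q.1 = _
  rw [h, map_smul]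
  simp [Matrix.kroneckerMap_apply, mul_comm]

/-- Quantum channels: trace-preserving, completely positive super-operators. -/
structure IsChannel {d : ℕ} (Φ : SuperOp d) : Prop where
  trace_preserving : ∀ X : Op d, (Φ X).trace = X.trace
  completely_positive : ∀ n : ℕ, 1 ≤ n → ∀ X : Matrix (Fin d × Fin n) (Fin d × Fin n) ℂ,
    X.PosSemidef → (ampliation n Φ X).PosSemidef

/-- `E` is a family of Kraus operators of `Φ`, that is `Φ = ∑ k, E k · (E k)†`. -/
def IsKraus {d m : ℕ} (Φ : SuperOp d) (E : Fin m → Op d) : Prop :=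
  ∀ X : Op d, Φ X = ∑ k, E k * X * (E k).conjTranspose

/-- The Kraus operator space `K(Φ)`: the linear span of the Kraus operators of `Φ`.
It is the span of any single Kraus family, see `krausSpace_eq_span`. -/
def krausSpace {d : ℕ} (Φ : SuperOp d) : Submodule ℂ (Op d) :=
  Submodule.span ℂ {A | ∃ (m : ℕ) (E : Fin m → Op d), IsKraus Φ E ∧ A ∈ Set.range E}

/-- The trace norm `‖X‖₁ = Tr |X|` with `|X| = √(X† X)`. -/
def traceNorm {ι : Type} [Fintype ι] [DecidableEq ι] (X : Matrix ι ι ℂ) : ℝ :=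
  (CFC.abs X).trace.re

/-- The norm `sup {‖Φ X‖₁ : ‖X‖₁ ≤ 1}` of a super-operator. -/
def superTraceNorm {ι : Type} [Fintype ι] [DecidableEq ι]
    (Φ : Matrix ι ι ℂ →ₗ[ℂ] Matrix ι ι ℂ) : ENNReal :=
  ⨆ (X : Matrix ι ι ℂ) (_ : traceNorm X ≤ 1), ENNReal.ofReal (traceNorm (Φ X))

/-- The diamond norm `sup_{n ≥ 1} ‖Φ ⊗ I_{L(H_n)}‖₁`. -/
def diamondNorm {d : ℕ} (Φ : SuperOp d) : ENNReal :=
  ⨆ (n : ℕ) (_ : 1 ≤ n), superTraceNorm (ampliation n Φ)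

/-- The unitary channel `X ↦ U X U†`, for unitary `U`. -/
def conjChannel {d : ℕ} (U : Op d) : SuperOp d :=
  LinearMap.mulRight ℂ U.conjTranspose ∘ₗ LinearMap.mulLeft ℂ U

/-- The set of unitary channels on `L(H_d)`. -/
def unitaryChannels (d : ℕ) : Set (SuperOp d) :=
  {Ψ | ∃ U ∈ Matrix.unitaryGroup (Fin d) ℂ, Ψ = conjChannel U}

/-- The distance from `Φ` to the convex hull of the unitary channels, in diamond norm. -/
def distConvUnitary {d : ℕ} (Φ : SuperOp d) : ENNReal :=
  ⨅ Ψ ∈ convexHull ℝ (unitaryChannels d), diamondNorm (Φ - Ψ)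

/-- The quantity `Tr (|L| - I)² / d`: the trace of the square of `|L| - I`, divided by `d`. -/
def unitaryDefect {d : ℕ} (L : Op d) : ℝ :=
  (((CFC.abs L - 1) ^ 2).trace).re / d

/-- For a Kraus family and a linear functional `f`, `∑ k, |f (E k)|²` depends only on `Φ`. -/
theorem IsKraus.sum_functional {d m : ℕ} {Φ : SuperOp d} {E : Fin m → Op d}
    (hE : IsKraus Φ E) (f : Op d →ₗ[ℂ] ℂ) :
    ∑ k, f (E k) * star (f (E k)) =
      ∑ a, ∑ i, ∑ b, ∑ j, f (Matrix.single a i 1) * star (f (Matrix.single b j 1)) *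
        Φ (Matrix.single i j 1) a b := by
  have h : ∀ i j a b, Φ (Matrix.single i j 1) a b = ∑ k, E k a i * star (E k b j) := by
    intro i j a b
    rw [hE, Matrix.sum_apply]
    refine Finset.sum_congr rfl fun k _ => ?_
    simp [Matrix.mul_apply, Matrix.single_apply, ite_and]
  have hf : ∀ A : Op d, f A = ∑ a, ∑ i, A a i * f (Matrix.single a i 1) := by
    intro A
    conv_lhs => rw [Matrix.matrix_eq_sum_single A]
    simp only [map_sum]
    refine Finset.sum_congr rfl fun a _ => Finset.sum_congr rfl fun i _ => ?_
    rw [← smul_eq_mul, ← map_smul, Matrix.smul_single, smul_eq_mul, mul_one]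
  have hk : ∀ k, f (E k) * star (f (E k)) = ∑ a, ∑ i, ∑ b, ∑ j,
      f (Matrix.single a i 1) * star (f (Matrix.single b j 1)) *
        (E k a i * star (E k b j)) := by
    intro k
    rw [hf (E k)]
    simp only [star_sum, star_mul', Finset.sum_mul]
    refine Finset.sum_congr rfl fun a _ => Finset.sum_congr rfl fun i _ => ?_
    simp only [Finset.mul_sum]
    refine Finset.sum_congr rfl fun b _ => Finset.sum_congr rfl fun j _ => ?_
    ring
  simp only [hk, h, Finset.mul_sum]
  rw [Finset.sum_comm]
  refine Finset.sum_congr rfl fun a _ => ?_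
  rw [Finset.sum_comm]
  refine Finset.sum_congr rfl fun i _ => ?_
  rw [Finset.sum_comm]
  refine Finset.sum_congr rfl fun b _ => ?_
  rw [Finset.sum_comm]

theorem IsKraus.mem_span {d m l : ℕ} {Φ : SuperOp d} {E : Fin m → Op d} {F : Fin l → Op d}
    (hE : IsKraus Φ E) (hF : IsKraus Φ F) (k : Fin l) :
    F k ∈ Submodule.span ℂ (Set.range E) := by
  by_contra hk
  obtain ⟨f, hne, hle⟩ := Submodule.exists_le_ker_of_notMem hk
  have hE0 : ∀ i, f (E i) = 0 := fun i => hle (Submodule.subset_span ⟨i, rfl⟩)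
  have h0 : ∑ i, f (F i) * star (f (F i)) = 0 := by
    rw [hF.sum_functional f, ← hE.sum_functional f]
    simp [hE0]
  have h1 := (Finset.sum_eq_zero_iff_of_nonneg
    (fun i _ => mul_star_self_nonneg (f (F i)))).1 h0 k (Finset.mem_univ k)
  rcases mul_eq_zero.1 h1 with h2 | h2
  · exact hne h2
  · exact hne (star_eq_zero.1 h2)

/-- The Kraus operator space is the span of any Kraus family of `Φ`. -/
theorem krausSpace_eq_span {d m : ℕ} {Φ : SuperOp d} {E : Fin m → Op d} (hE : IsKraus Φ E) :
    krausSpace Φ = Submodule.span ℂ (Set.range E) := by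
  apply le_antisymm
  · refine Submodule.span_le.2 ?_
    rintro A ⟨l, F, hF, k, rfl⟩
    exact hE.mem_span hF k
  · refine Submodule.span_mono ?_
    rintro A hA
    exact ⟨m, E, hE, hA⟩

end QChannel

end

/-! Let `P` be the orthogonal projection onto the complement of the vectorized Kraus space `K(Φ)`.
The Choi matrix of a map with Kraus operators `E k` is `∑ |E k⟩⟨E k|`, so `P` has trace zero against
the Choi matrix of `Φ`. Against that of a unitary channel it gives `‖P vec U‖²`, the squared
Hilbert–Schmidt distance from `U` to `K(Φ)`. By polar decomposition `Tr (|L| - I)²` is the squared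
distance from `L` to the nearest unitary, so this value is at least `d * C`
(`exists_isLeast_unitaryDefect`). The bound is affine in the channel and passes to the convex hull.
Since `P` is a contraction, `re_trace_mul_le_traceNorm` turns it into a trace-norm bound on the Choi
matrix of `Ψ - Φ`; dividing by `d` amounts to testing on the maximally entangled state
(`ofReal_le_diamondNorm`). -/

namespace QChannel

/-- Two linear maps with the same pointwise norms differ by an isometry on the left. -/
theorem exists_linearIsometry_comp_eq {E : Type*} [NormedAddCommGroup E] [InnerProductSpace ℂ E]
    [FiniteDimensional ℂ E] (f g : E →ₗ[ℂ] E) (h : ∀ x, ‖f x‖ = ‖g x‖) :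
    ∃ V : E →ₗᵢ[ℂ] E, ∀ x, V (g x) = f x := by
  obtain ⟨s, hs⟩ := g.rangeRestrict.exists_rightInverse_of_surjective g.range_rangeRestrict
  have hgs : ∀ y : LinearMap.range g, g (s y) = y := fun y =>
    congrArg Subtype.val (LinearMap.congr_fun hs y)
  let T : LinearMap.range g →ₗᵢ[ℂ] E :=
    ⟨f ∘ₗ s, fun y => by rw [LinearMap.comp_apply, h, hgs]; rfl⟩
  refine ⟨T.extend, fun x => ?_⟩
  have hT := T.extend_apply ⟨g x, LinearMap.mem_range_self g x⟩
  refine hT.trans ?_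
  change f (s ⟨g x, _⟩) = f x
  -- The choice of preimage is harmless: equal norms force `f` and `g` to have the same kernel.
  rw [← sub_eq_zero, ← map_sub, ← norm_eq_zero, h, map_sub, hgs, sub_self, norm_zero]

/-! ### Polar decomposition and trace-norm duality -/

section

variable {ι : Type} [Fintype ι] [DecidableEq ι]

theorem posSemidef_abs (X : Matrix ι ι ℂ) : (CFC.abs X).PosSemidef :=
  Matrix.nonneg_iff_posSemidef.1 (CFC.abs_nonneg X)

theorem abs_mul_abs (X : Matrix ι ι ℂ) : CFC.abs X * CFC.abs X = X.conjTranspose * X :=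
  CFC.abs_mul_abs X

/-- Polar decomposition. -/
theorem exists_unitary_mul_abs (X : Matrix ι ι ℂ) :
    ∃ V ∈ Matrix.unitaryGroup ι ℂ, X = V * CFC.abs X := by
  let e := Matrix.toEuclideanCLM (n := ι) (𝕜 := ℂ)
  have hns : ∀ (A : Matrix ι ι ℂ) x, ‖e A x‖ ^ 2 = RCLike.re (inner ℂ (e (star A * A) x) x) := by
    intro A x
    rw [map_mul, map_star, ContinuousLinearMap.star_eq_adjoint]
    exact (e A).apply_norm_sq_eq_inner_adjoint_left x
  have hn : ∀ x, ‖e X x‖ = ‖e (CFC.abs X) x‖ := by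
    intro x
    rw [← sq_eq_sq₀ (norm_nonneg _) (norm_nonneg _), hns, hns]
    congr 4
    rw [Matrix.star_eq_conjTranspose, ← abs_mul_abs, Matrix.star_eq_conjTranspose,
      (posSemidef_abs X).1]
  obtain ⟨V, hV⟩ := exists_linearIsometry_comp_eq (e X).toLinearMap (e (CFC.abs X)).toLinearMap hn
  have hVV : star V.toContinuousLinearMap * V.toContinuousLinearMap = 1 :=
    V.toContinuousLinearMap.norm_map_iff_adjoint_comp_self.1 V.norm_map
  obtain ⟨W, hW⟩ := EquivLike.surjective e V.toContinuousLinearMap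
  refine ⟨W, ?_, EquivLike.injective e ?_⟩
  · rw [Matrix.mem_unitaryGroup_iff']
    apply EquivLike.injective e
    rw [map_mul, map_star, hW, hVV, map_one]
  · rw [map_mul, hW]
    ext1 x
    exact (hV x).symm

theorem trace_mul_nonneg {A B : Matrix ι ι ℂ} (hA : A.PosSemidef) (hB : B.PosSemidef) :
    0 ≤ (A * B).trace := by
  obtain ⟨C, rfl⟩ := CStarAlgebra.nonneg_iff_eq_star_mul_self.1 (Matrix.nonneg_iff_posSemidef.2 hA)
  rw [Matrix.mul_assoc, Matrix.trace_mul_comm]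
  exact (hB.mul_mul_conjTranspose_same C).trace_nonneg

/-- A contraction has at most the trace norm as trace against `X`. -/
theorem re_trace_mul_le_traceNorm {W : Matrix ι ι ℂ}
    (hW : (1 - W * W.conjTranspose).PosSemidef) (X : Matrix ι ι ℂ) :
    (W * X).trace.re ≤ traceNorm X := by
  obtain ⟨V, hV, hX⟩ := exists_unitary_mul_abs X
  have hVV : V * V.conjTranspose = 1 := Matrix.mem_unitaryGroup_iff.1 hV
  set P := CFC.abs X with hP
  have hPs : P.PosSemidef := posSemidef_abs X
  set A := W * V with hA
  have hAA : A * A.conjTranspose = W * W.conjTranspose := by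
    rw [hA, Matrix.conjTranspose_mul, Matrix.mul_assoc, ← Matrix.mul_assoc V, hVV, Matrix.one_mul]
  -- This is `(1 - A)(1 - A)† + (1 - A A†)`; pairing it with `P ≥ 0` gives `Re Tr (P A) ≤ Tr P`.
  have hM : (2 - A - A.conjTranspose).PosSemidef := by
    have h := (Matrix.posSemidef_self_mul_conjTranspose (1 - A)).add hW
    rw [← hAA] at h
    convert h using 1
    rw [Matrix.conjTranspose_sub, Matrix.conjTranspose_one, ← one_add_one_eq_two]
    noncomm_ring
  have h0 := (Complex.le_def.1 (trace_mul_nonneg hPs hM)).1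
  have hconj : (P * A.conjTranspose).trace.re = (P * A).trace.re := by
    rw [Matrix.trace_mul_comm]
    nth_rewrite 1 [← hPs.1]
    rw [← Matrix.conjTranspose_mul, Matrix.trace_conjTranspose]
    simp
  have hexp : P * (2 - A - A.conjTranspose) = P + P - P * A - P * A.conjTranspose := by
    rw [← one_add_one_eq_two]
    noncomm_ring
  rw [hexp] at h0
  simp only [Matrix.trace_sub, Matrix.trace_add, Complex.sub_re, Complex.add_re, hconj,
    Complex.zero_re] at h0
  have hWX : (W * X).trace = (P * A).trace := by
    rw [Matrix.trace_mul_comm P, hA, Matrix.mul_assoc, ← hX]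
  rw [hWX, traceNorm, ← hP]
  linarith

end

/-! ### The defect as a distance to the unitary group -/

section

variable {d : ℕ}

theorem trace_conjTranspose_mul_sub {U : Op d} (hU : U ∈ Matrix.unitaryGroup (Fin d) ℂ)
    (L : Op d) :
    ((U - L).conjTranspose * (U - L)).trace.re
      = d + (L.conjTranspose * L).trace.re - 2 * (U.conjTranspose * L).trace.re := by
  have h1 : U.conjTranspose * U = 1 := Matrix.mem_unitaryGroup_iff'.1 hU
  have h2 : (L.conjTranspose * U).trace.re = (U.conjTranspose * L).trace.re := by
    rw [← Matrix.conjTranspose_conjTranspose U, ← Matrix.conjTranspose_mul,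
      Matrix.trace_conjTranspose]
    simp
  rw [Matrix.conjTranspose_sub, Matrix.sub_mul, Matrix.mul_sub, Matrix.mul_sub, h1]
  simp only [Matrix.trace_sub, Complex.sub_re, h2]
  simp
  ring

theorem mul_unitaryDefect [NeZero d] (L : Op d) :
    d * unitaryDefect L = d + (L.conjTranspose * L).trace.re - 2 * (CFC.abs L).trace.re := by
  have hd : (d : ℝ) ≠ 0 := NeZero.ne _
  rw [unitaryDefect, mul_div_cancel₀ _ hd, ← abs_mul_abs]
  have : (CFC.abs L - 1) ^ 2 = CFC.abs L * CFC.abs L - CFC.abs L - CFC.abs L + 1 := by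
    noncomm_ring
  rw [this]
  simp
  ring

/-- `Tr (|L| - I)²` is at most the squared Hilbert-Schmidt distance of `L` to any unitary. -/
theorem mul_unitaryDefect_le [NeZero d] {U : Op d} (hU : U ∈ Matrix.unitaryGroup (Fin d) ℂ)
    (L : Op d) :
    d * unitaryDefect L ≤ ((U - L).conjTranspose * (U - L)).trace.re := by
  rw [mul_unitaryDefect, trace_conjTranspose_mul_sub hU]
  have h1 : U.conjTranspose * U = 1 := Matrix.mem_unitaryGroup_iff'.1 hU
  have := re_trace_mul_le_traceNorm (W := U.conjTranspose)
    (by rw [Matrix.conjTranspose_conjTranspose, h1, sub_self]; exact Matrix.PosSemidef.zero) L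
  rw [traceNorm] at this
  linarith

/-- `Tr (|L| - I)²` is the squared Hilbert-Schmidt distance of `L` to some unitary. -/
theorem exists_unitary_mul_unitaryDefect_eq [NeZero d] (L : Op d) :
    ∃ U ∈ Matrix.unitaryGroup (Fin d) ℂ,
      d * unitaryDefect L = ((U - L).conjTranspose * (U - L)).trace.re := by
  obtain ⟨V, hV, hL⟩ := exists_unitary_mul_abs L
  refine ⟨V, hV, ?_⟩
  have h1 : V.conjTranspose * V = 1 := Matrix.mem_unitaryGroup_iff'.1 hV
  have h2 : V.conjTranspose * L = CFC.abs L := by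
    conv_lhs => rw [hL]
    rw [← Matrix.mul_assoc, h1, Matrix.one_mul]
  rw [mul_unitaryDefect, trace_conjTranspose_mul_sub hV, h2]

theorem unitaryDefect_pos [NeZero d] {L : Op d} (hL : L ∉ Matrix.unitaryGroup (Fin d) ℂ) :
    0 < unitaryDefect L := by
  have hd : (0 : ℝ) < d := Nat.cast_pos.2 (Nat.pos_of_ne_zero (NeZero.ne d))
  obtain ⟨U, hU, h⟩ := exists_unitary_mul_unitaryDefect_eq L
  have h0 := (Matrix.posSemidef_conjTranspose_mul_self (U - L)).trace_nonneg
  have hne : ((U - L).conjTranspose * (U - L)).trace ≠ 0 := by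
    rw [Ne, Matrix.trace_conjTranspose_mul_self_eq_zero_iff, sub_eq_zero]
    rintro rfl
    exact hL hU
  have := (Complex.lt_def.1 (lt_of_le_of_ne h0 hne.symm)).1
  rw [← h] at this
  exact (mul_pos_iff_of_pos_left hd).1 this

end

/-! ### Vectorization, Choi matrices and Kraus families -/

section

variable {d : ℕ}

/-- The vectorization of an operator. -/
noncomputable def vec : Op d ≃ₗ[ℂ] EuclideanSpace ℂ (Fin d × Fin d) :=
  (LinearEquiv.curry ℂ ℂ (Fin d) (Fin d)).symm ≪≫ₗ (WithLp.linearEquiv 2 ℂ _).symm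

@[simp]
theorem vec_apply (A : Op d) (p : Fin d × Fin d) : vec A p = A p.1 p.2 := rfl

theorem norm_vec_sq (A : Op d) : ‖vec A‖ ^ 2 = (A.conjTranspose * A).trace.re := by
  rw [EuclideanSpace.norm_sq_eq, Fintype.sum_prod_type, Finset.sum_comm, Matrix.trace,
    Complex.re_sum]
  refine Finset.sum_congr rfl fun i _ => ?_
  rw [Matrix.diag_apply, Matrix.mul_apply, Complex.re_sum]
  refine Finset.sum_congr rfl fun j _ => ?_
  rw [Matrix.conjTranspose_apply, vec_apply, ← Complex.normSq_eq_norm_sq, Complex.star_def,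
    ← Complex.normSq_eq_conj_mul_self, Complex.ofReal_re]

/-- The unnormalized maximally entangled operator. -/
def maxEntangled (d : ℕ) : Matrix (Fin d × Fin d) (Fin d × Fin d) ℂ :=
  Matrix.vecMulVec (fun p => if p.1 = p.2 then 1 else 0) (fun p => if p.1 = p.2 then 1 else 0)

theorem posSemidef_maxEntangled : (maxEntangled d).PosSemidef := by
  have h := Matrix.posSemidef_vecMulVec_self_star
    (fun p : Fin d × Fin d => if p.1 = p.2 then (1 : ℂ) else 0)
  convert h using 1
  rw [maxEntangled]
  congr 1
  ext p
  simp only [Pi.star_apply]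
  split_ifs <;> simp

theorem trace_maxEntangled : (maxEntangled d).trace = d := by
  simp [maxEntangled, Matrix.trace, Matrix.vecMulVec_apply, Fintype.sum_prod_type]

/-- The Choi matrix. -/
def choi : SuperOp d →ₗ[ℂ] Matrix (Fin d × Fin d) (Fin d × Fin d) ℂ where
  toFun Φ := ampliation d Φ (maxEntangled d)
  map_add' _ _ := rfl
  map_smul' _ _ := rfl

theorem choi_apply (Φ : SuperOp d) (p q : Fin d × Fin d) :
    choi Φ p q = Φ (Matrix.single p.2 q.2 1) p.1 q.1 := by
  change Φ (Matrix.of fun i j => maxEntangled d (i, p.2) (j, q.2)) p.1 q.1 = _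
  have h : (Matrix.of fun i j => maxEntangled d (i, p.2) (j, q.2) : Op d)
      = Matrix.single p.2 q.2 1 := by
    ext i j
    simp only [maxEntangled, Matrix.vecMulVec_apply, Matrix.of_apply, Matrix.single_apply,
      eq_comm (a := i), eq_comm (a := j), ite_and, ite_mul, one_mul, zero_mul]
  rw [h]

theorem IsKraus.choi_apply {m : ℕ} {Φ : SuperOp d} {E : Fin m → Op d} (hE : IsKraus Φ E)
    (p q : Fin d × Fin d) :
    choi Φ p q = ∑ k, vec (E k) p * star (vec (E k) q) := by
  rw [QChannel.choi_apply, hE, Matrix.sum_apply]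
  refine Finset.sum_congr rfl fun k _ => ?_
  simp [Matrix.mul_apply, Matrix.single_apply, ite_and]

theorem choi_injective : Function.Injective (choi (d := d)) := by
  intro Φ Ψ h
  apply Matrix.ext_linearMap
  intro i j
  apply LinearMap.ext_ring
  ext a b
  have := congrFun (congrFun h (a, i)) (b, j)
  rw [choi_apply, choi_apply] at this
  simpa using this

/-- The completely positive map with a given Kraus family. -/
def krausMap {m : ℕ} (E : Fin m → Op d) : SuperOp d :=
  ∑ k, LinearMap.mulRight ℂ (E k).conjTranspose ∘ₗ LinearMap.mulLeft ℂ (E k)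

theorem isKraus_krausMap {m : ℕ} (E : Fin m → Op d) : IsKraus (krausMap E) E := by
  intro X
  simp [krausMap, LinearMap.sum_apply]

/-- Choi's theorem: a map with positive semidefinite Choi matrix has a Kraus family. -/
theorem exists_isKraus {Φ : SuperOp d} (h : (choi Φ).PosSemidef) :
    ∃ (m : ℕ) (E : Fin m → Op d), IsKraus Φ E := by
  obtain ⟨B, hB⟩ := CStarAlgebra.nonneg_iff_eq_star_mul_self.1 (Matrix.nonneg_iff_posSemidef.2 h)
  let e := Fintype.equivFin (Fin d × Fin d)
  -- From `choi Φ = B† B`, the conjugated rows of `B`, reshaped to matrices, are Kraus operators.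
  let E : Fin (Fintype.card (Fin d × Fin d)) → Op d :=
    fun k => Matrix.of fun a i => star (B (e.symm k) (a, i))
  refine ⟨_, E, ?_⟩
  have : Φ = krausMap E := by
    apply choi_injective
    ext p q
    rw [(isKraus_krausMap E).choi_apply, hB, Matrix.mul_apply, ← e.symm.sum_comp]
    refine Finset.sum_congr rfl fun k _ => ?_
    simp [E]
  rw [this]
  exact isKraus_krausMap E

theorem isKraus_conjChannel (U : Op d) : IsKraus (conjChannel U) (fun _ : Fin 1 => U) := by
  intro X
  simp [conjChannel]

/-- The trace of a matrix against a Choi matrix, in terms of a Kraus family. -/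
theorem IsKraus.trace_mul_choi {m : ℕ} {Φ : SuperOp d} {E : Fin m → Op d} (hE : IsKraus Φ E)
    (W : Matrix (Fin d × Fin d) (Fin d × Fin d) ℂ) :
    (W * choi Φ).trace =
      ∑ k, inner ℂ (vec (E k)) (Matrix.toEuclideanCLM (𝕜 := ℂ) W (vec (E k))) := by
  have h : choi Φ = ∑ k, Matrix.vecMulVec (vec (E k)).ofLp (star (vec (E k)).ofLp) := by
    ext p q
    rw [hE.choi_apply, Matrix.sum_apply]
    rfl
  rw [h, Matrix.mul_sum, Matrix.trace_sum]
  refine Finset.sum_congr rfl fun k _ => ?_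
  rw [Matrix.mul_vecMulVec, Matrix.trace_vecMulVec]
  rfl

end

/-! ### Projection off the Kraus space and attainment of the minimum -/

section

variable {d : ℕ} (K : Submodule ℂ (Op d))

/-- The orthogonal projection onto the complement of the vectorization of `K`. -/
noncomputable def vecCompl :
    EuclideanSpace ℂ (Fin d × Fin d) →L[ℂ] EuclideanSpace ℂ (Fin d × Fin d) :=
  ((K.map (vec (d := d)).toLinearMap)ᗮ).starProjection

theorem vecCompl_vec_eq_zero {A : Op d} (hA : A ∈ K) : vecCompl K (vec A) = 0 :=
  (K.map vec.toLinearMap).starProjection_orthogonal_apply_eq_zero (Submodule.mem_map_of_mem hA)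

/-- The witness `L` is the Hilbert–Schmidt projection of `U` onto `K`, hence its nearest point
there. -/
theorem exists_mem_vecCompl_vec_eq (U : Op d) :
    ∃ L ∈ K, vecCompl K (vec U) = vec (U - L) := by
  obtain ⟨L, hL, h⟩ := (K.map (vec (d := d)).toLinearMap).starProjection_apply_mem (vec U)
  refine ⟨L, hL, ?_⟩
  have h' : vec L = _ := h
  rw [vecCompl, Submodule.starProjection_orthogonal_val, map_sub, h']

theorem norm_vecCompl_vec_le {L : Op d} (hL : L ∈ K) (U : Op d) :
    ‖vecCompl K (vec U)‖ ≤ ‖vec (U - L)‖ := by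
  have h : vecCompl K (vec U) = vecCompl K (vec (U - L)) := by
    rw [map_sub, map_sub, vecCompl_vec_eq_zero K hL, sub_zero]
  rw [h]
  exact Submodule.norm_starProjection_apply_le (K.map vec.toLinearMap)ᗮ _

theorem re_inner_vecCompl (x : EuclideanSpace ℂ (Fin d × Fin d)) :
    (inner ℂ x (vecCompl K x)).re = ‖vecCompl K x‖ ^ 2 := by
  rw [← inner_conj_symm, Complex.conj_re]
  exact Submodule.re_inner_starProjection_eq_normSq (K.map vec.toLinearMap)ᗮ x

/-- Puts the projection in the form of a test matrix for `re_trace_mul_le_traceNorm`. -/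
theorem exists_matrix_vecCompl :
    ∃ W : Matrix (Fin d × Fin d) (Fin d × Fin d) ℂ,
      Matrix.toEuclideanCLM (𝕜 := ℂ) W = vecCompl K ∧ (1 - W * W.conjTranspose).PosSemidef := by
  have hi : vecCompl K * vecCompl K = vecCompl K := Submodule.isIdempotentElem_starProjection _
  have hs : star (vecCompl K) = vecCompl K := isSelfAdjoint_starProjection _
  obtain ⟨W, hW⟩ := EquivLike.surjective (Matrix.toEuclideanCLM (𝕜 := ℂ)) (vecCompl K)
  refine ⟨W, hW, ?_⟩
  have hWi : W * W = W := by
    apply EquivLike.injective (Matrix.toEuclideanCLM (𝕜 := ℂ) (n := Fin d × Fin d))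
    rw [map_mul, hW, hi]
  have hWs : W.conjTranspose = W := by
    apply EquivLike.injective (Matrix.toEuclideanCLM (𝕜 := ℂ) (n := Fin d × Fin d))
    rw [← Matrix.star_eq_conjTranspose, map_star, hW, hs]
  have h : 1 - W * W.conjTranspose = (1 - W).conjTranspose * (1 - W) := by
    rw [Matrix.conjTranspose_sub, hWs, Matrix.conjTranspose_one, Matrix.sub_mul, Matrix.mul_sub W,
      hWi]
    simp
  rw [h]
  exact Matrix.posSemidef_conjTranspose_mul_self _

theorem isCompact_unitaryGroup : IsCompact (Matrix.unitaryGroup (Fin d) ℂ : Set (Op d)) := by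
  have hc : IsClosed (Matrix.unitaryGroup (Fin d) ℂ : Set (Op d)) := by
    have : (Matrix.unitaryGroup (Fin d) ℂ : Set (Op d)) = {U | U * star U = 1} := by
      ext U; exact Matrix.mem_unitaryGroup_iff
    rw [this]
    exact isClosed_eq (continuous_id.mul continuous_id.star) continuous_const
  refine IsCompact.of_isClosed_subset
    (isCompact_univ_pi fun _ : Fin d => isCompact_univ_pi fun _ : Fin d =>
      isCompact_closedBall (0 : ℂ) 1) hc fun U hU i _ j _ => ?_
  rw [mem_closedBall_zero_iff]
  exact entry_norm_bound_of_unitary hU i j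

/-- The defect attains its minimum on `K`, and bounds the distance of unitaries to `K`. -/
theorem exists_isLeast_unitaryDefect [NeZero d] :
    ∃ L ∈ K, (∀ M ∈ K, unitaryDefect L ≤ unitaryDefect M) ∧
      ∀ U ∈ Matrix.unitaryGroup (Fin d) ℂ, d * unitaryDefect L ≤ ‖vecCompl K (vec U)‖ ^ 2 := by
  have hd : (0 : ℝ) < d := Nat.cast_pos.2 (Nat.pos_of_ne_zero (NeZero.ne d))
  have hcont : Continuous fun U : Op d => ‖vecCompl K (vec U)‖ ^ 2 := by
    have : Continuous (vec (d := d)) := (vec (d := d)).toLinearMap.continuous_of_finiteDimensional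
    fun_prop
  -- The joint minimum of `‖U - L‖²` is taken over `U` first: the unitary group is compact, whereas
  -- `K` need not be.
  obtain ⟨U, hU, hmin⟩ := isCompact_unitaryGroup.exists_isMinOn
    ⟨1, one_mem (Matrix.unitaryGroup (Fin d) ℂ)⟩ hcont.continuousOn
  obtain ⟨L, hL, hUL⟩ := exists_mem_vecCompl_vec_eq K U
  have hle : d * unitaryDefect L ≤ ‖vecCompl K (vec U)‖ ^ 2 := by
    rw [hUL, norm_vec_sq]
    exact mul_unitaryDefect_le hU L
  refine ⟨L, hL, fun M hM => ?_, fun V hV => hle.trans (hmin hV)⟩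
  obtain ⟨V, hV, hVM⟩ := exists_unitary_mul_unitaryDefect_eq M
  refine le_of_mul_le_mul_left (hle.trans ((hmin hV).trans ?_)) hd
  rw [hVM, ← norm_vec_sq]
  exact pow_le_pow_left₀ (norm_nonneg _) (norm_vecCompl_vec_le K hM V) 2

end

/-! ### Lower bound on the diamond norm -/

section

variable {d : ℕ}

theorem traceNorm_of_posSemidef {ι : Type} [Fintype ι] [DecidableEq ι] {X : Matrix ι ι ℂ}
    (hX : X.PosSemidef) : traceNorm X = X.trace.re := by
  rw [traceNorm, CFC.abs_of_nonneg X (Matrix.nonneg_iff_posSemidef.2 hX)]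

/-- Testing on the maximally entangled state bounds the diamond norm from below. -/
theorem ofReal_le_diamondNorm [NeZero d] {Θ : SuperOp d} {c : ℝ}
    {W : Matrix (Fin d × Fin d) (Fin d × Fin d) ℂ}
    (hW : (1 - W * W.conjTranspose).PosSemidef) (hc : d * c ≤ (W * choi Θ).trace.re) :
    ENNReal.ofReal c ≤ diamondNorm Θ := by
  have hd : (0 : ℝ) < d := Nat.cast_pos.2 (Nat.pos_of_ne_zero (NeZero.ne d))
  set ω := ((d : ℝ)⁻¹ : ℂ) • maxEntangled d with hω
  have hpos : (0 : ℂ) ≤ ((d : ℝ)⁻¹ : ℂ) := by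
    rw [← Complex.ofReal_inv]; exact Complex.zero_le_real.2 (inv_nonneg.2 hd.le)
  have hnorm : traceNorm ω ≤ 1 := by
    rw [traceNorm_of_posSemidef (posSemidef_maxEntangled.smul hpos), Matrix.trace_smul,
      trace_maxEntangled]
    have : (d : ℂ) ≠ 0 := NeZero.ne _
    simp [this]
  have hamp : ampliation d Θ ω = ((d : ℝ)⁻¹ : ℂ) • choi Θ := map_smul _ _ _
  have hle : c ≤ traceNorm (ampliation d Θ ω) := by
    refine le_trans ?_ (re_trace_mul_le_traceNorm hW _)
    rw [hamp, Matrix.mul_smul, Matrix.trace_smul, smul_eq_mul, ← Complex.ofReal_inv,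
      Complex.re_ofReal_mul, inv_mul_eq_div, le_div_iff₀ hd, mul_comm]
    exact hc
  refine (ENNReal.ofReal_le_ofReal hle).trans ?_
  refine le_iSup₂_of_le d (Nat.pos_of_ne_zero (NeZero.ne d)) ?_
  exact le_iSup₂_of_le (f := fun X _ => ENNReal.ofReal (traceNorm (ampliation d Θ X)))
    ω hnorm le_rfl

theorem diamondNorm_neg (Θ : SuperOp d) : diamondNorm (-Θ) = diamondNorm Θ := by
  have h : ∀ n X, ampliation n (-Θ) X = -ampliation n Θ X := fun _ _ => rfl
  simp only [diamondNorm, superTraceNorm, traceNorm, h, CFC.abs_neg]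

end

end QChannel

theorem lemma2 (d : ℕ) (Φ : QChannel.SuperOp d) (hΦ : QChannel.IsChannel Φ)
    (hK : ∀ U ∈ QChannel.krausSpace Φ, U ∉ Matrix.unitaryGroup (Fin d) ℂ) :
    ∃ C : ℝ,
      IsLeast {c : ℝ | ∃ L ∈ QChannel.krausSpace Φ, c = QChannel.unitaryDefect L} C ∧
      0 < C ∧
      ENNReal.ofReal C ≤ QChannel.distConvUnitary Φ := by
  open QChannel in
  rcases Nat.eq_zero_or_pos d with rfl | hd
  -- In dimension zero the zero operator is unitary, contradicting `hK`.
  · exact absurd (Matrix.mem_unitaryGroup_iff.2 (Subsingleton.elim _ _))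
      (hK 0 (krausSpace Φ).zero_mem)
  have : NeZero d := ⟨hd.ne'⟩
  obtain ⟨L, hL, hmin, hU⟩ := exists_isLeast_unitaryDefect (krausSpace Φ)
  refine ⟨unitaryDefect L, ⟨⟨L, hL, rfl⟩, ?_⟩, unitaryDefect_pos (hK L hL), ?_⟩
  · rintro _ ⟨M, hM, rfl⟩
    exact hmin M hM
  obtain ⟨m, E, hE⟩ := exists_isKraus
    (hΦ.completely_positive d hd _ posSemidef_maxEntangled : (choi Φ).PosSemidef)
  obtain ⟨W, hW, hW1⟩ := exists_matrix_vecCompl (krausSpace Φ)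
  have hWΦ : (W * choi Φ).trace = 0 := by
    rw [hE.trace_mul_choi, hW]
    refine Finset.sum_eq_zero fun k _ => ?_
    have hk : E k ∈ krausSpace Φ := Submodule.subset_span ⟨m, E, hE, k, rfl⟩
    rw [vecCompl_vec_eq_zero _ hk, inner_zero_right]
  let f : SuperOp d →ₗ[ℝ] ℝ := Complex.reLm ∘ₗ
    ((Matrix.traceLinearMap (Fin d × Fin d) ℂ ℂ ∘ₗ LinearMap.mulLeft ℂ W ∘ₗ choi).restrictScalars ℝ)
  have hf : ∀ Ψ, f Ψ = (W * choi Ψ).trace.re := fun _ => rfl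
  have hsub : convexHull ℝ (unitaryChannels d) ⊆ {Ψ | d * unitaryDefect L ≤ f Ψ} := by
    refine convexHull_min ?_ (convex_halfSpace_ge f.isLinear _)
    rintro _ ⟨U, hUu, rfl⟩
    rw [Set.mem_ofPred_eq, hf, (isKraus_conjChannel U).trace_mul_choi, hW, Fin.sum_univ_one,
      re_inner_vecCompl]
    exact hU U hUu
  refine le_iInf₂ fun Ψ hΨ => ?_
  -- The sign is flipped because `W` pairs to zero with `Φ` and to at least `d * C` with `Ψ`.
  rw [← neg_sub, diamondNorm_neg]
  refine ofReal_le_diamondNorm hW1 ?_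
  rw [map_sub, Matrix.mul_sub, Matrix.trace_sub, hWΦ, sub_zero]
  exact hsub hΨ
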